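/- Let $\Omega=\mathbb{R}\times[0,1]\subset\mathbb{R}^2$, let $L^2(\Omega)$ be the space of (classes of) real-valued functions that are square integrable on $\Omega$ with respect to Lebesgue measure, and let $\phi(x)=1/(1+e^{-x})$ be the logistic function. Let $\mathcal{S}_2(\phi)$ denote the set of all functions on $\mathbb{R}^2$ of the form $$x\mapsto\sum_{i=1}^{k}t_i\,\phi(\langle y_i,x\rangle+\theta_i),\qquad k\in\mathbb{N},\ y_i\in\mathbb{R}^2,\ \theta_i\in\mathbb{R},\ t_i\in\mathbb{R},$$ where $\langle\cdot,\cdot\rangle$ is the dot product. Then $$\overline{\mathcal{S}_2(\phi)\cap L^2(\Omega)}=L^2(\Omega),$$ where $\mathcal{S}_2(\phi)\cap L^2(\Omega)$ consists of the elements of $\mathcal{S}_2(\phi)$ whose restriction to $\Omega$ is square integrable (as classes in $L^2(\Omega)$), and the closure is taken in the norm of $L^2(\Omega)$. -/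

import Mathlib

open MeasureTheory

noncomputable section

/-- The ridge function `x ↦ ψ (⟨y, x⟩ + θ)` on `ℝⁿ`. -/
def ridge {n : ℕ} (ψ : ℝ → ℝ) (y : EuclideanSpace ℝ (Fin n)) (θ : ℝ) :
    EuclideanSpace ℝ (Fin n) → ℝ :=
  fun x => ψ (inner ℝ y x + θ)

/-- The set `𝒮ₙ(ψ)` of functions on `ℝⁿ` represented by a shallow network with activation `ψ`:
all finite linear combinations `∑ tᵢ ψ(⟨yᵢ, ·⟩ + θᵢ)`. -/
def shallowNetworks (n : ℕ) (ψ : ℝ → ℝ) : Set (EuclideanSpace ℝ (Fin n) → ℝ) :=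
  {G | ∃ (k : ℕ) (t : Fin k → ℝ) (y : Fin k → EuclideanSpace ℝ (Fin n)) (θ : Fin k → ℝ),
    G = ∑ i, t i • ridge ψ (y i) (θ i)}

/-- The strip `ℝ × [0, 1]` in the Euclidean plane. -/
def strip : Set (EuclideanSpace ℝ (Fin 2)) :=
  {x | x 1 ∈ Set.Icc (0 : ℝ) 1}

/-- The real Hilbert space `L²(U)` for Lebesgue measure on `U ⊆ ℝⁿ`. -/
abbrev L2On {n : ℕ} (U : Set (EuclideanSpace ℝ (Fin n))) :=
  Lp ℝ 2 (volume.restrict U)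

/-- `𝒳 ∩ L²(U)`: the elements of `L²(U)` given by the functions of `𝒳` that are
square integrable on `U`. -/
def interL2 {n : ℕ} (𝒳 : Set (EuclideanSpace ℝ (Fin n) → ℝ))
    (U : Set (EuclideanSpace ℝ (Fin n))) : Set (L2On U) :=
  {F | ∃ G ∈ 𝒳, ∃ hG : MemLp G 2 (volume.restrict U), F = hG.toLp G}

end

/-! Write `u = x 0`, `v = x 1`, `σ` for the logistic function. On the strip `v` is bounded, so for
`a > 0` the difference of two parallel ridges `σ (a u + b v + c) - σ (a u + b v + c')` decays
exponentially in `u` and is square integrable. By Hilbert space duality it suffices that a `g` in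
`L²` orthogonal to all these differences vanishes.

Differentiating in `c` gives `∫ g σ' (a u + b v + c) = 0` for all `b`, `c`. A further derivative in
`b` brings down a factor `v`, and the resulting `∫ v g σ''` is also the `c`-derivative of `∫ v g
σ'`. The latter is thus constant in `c`; it tends to zero as `c → ∞`, so it vanishes and `v g`
inherits the orthogonality (`integral_coord_mul_sigmoidDeriv_eq_zero`). By induction so does every
`v ^ n g`.

Now take `b = 0`, integrate back in `c`, and let `a → ∞`: the differences become indicators of slabs
`p < u < q` (`setIntegral_preimage_Ioo_eq_zero`). All `v`-moments of `g` over slabs vanish, so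
uniqueness in the Hausdorff moment problem (`setIntegral_preimage_eq_zero_of_moments`) kills the
integrals over bounded rectangles, and `g = 0`. -/

open Filter Topology Real

/-! ### Exponential estimates for the logistic function -/

/-- The derivative of the logistic function. -/
noncomputable def sigmoidDeriv (z : ℝ) : ℝ := sigmoid z * (1 - sigmoid z)

lemma sigmoidDeriv_nonneg (z : ℝ) : 0 ≤ sigmoidDeriv z :=
  mul_nonneg (sigmoid_nonneg z) (sub_nonneg.2 (sigmoid_le_one z))

lemma sigmoid_le_exp (z : ℝ) : sigmoid z ≤ exp z := by
  have h := sigmoid_mul_rexp_neg z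
  have h1 : sigmoid z = sigmoid (-z) * exp z := by
    rw [← h, mul_assoc, ← exp_add]; simp
  rw [h1]
  exact mul_le_of_le_one_left (exp_pos z).le (sigmoid_le_one _)

lemma one_sub_sigmoid_le_exp_neg (z : ℝ) : 1 - sigmoid z ≤ exp (-z) := by
  rw [← sigmoid_neg]; exact sigmoid_le_exp _

lemma sigmoidDeriv_le_exp (z : ℝ) : sigmoidDeriv z ≤ exp (-|z|) := by
  have h0 := sigmoid_nonneg z
  have h1 := sigmoid_le_one z
  have h2 := sigmoid_le_exp z
  have h3 := one_sub_sigmoid_le_exp_neg z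
  unfold sigmoidDeriv
  rcases abs_cases z with ⟨h, -⟩ | ⟨h, -⟩ <;> rw [h]
  · nlinarith
  · rw [neg_neg]; nlinarith

lemma hasDerivAt_sigmoidDeriv (z : ℝ) :
    HasDerivAt sigmoidDeriv (sigmoidDeriv z * (1 - 2 * sigmoid z)) z := by
  have h := hasDerivAt_sigmoid z
  refine (h.mul (h.const_sub 1)).congr_deriv ?_
  unfold sigmoidDeriv; ring

lemma continuous_sigmoidDeriv : Continuous sigmoidDeriv :=
  continuous_sigmoid.mul (continuous_const.sub continuous_sigmoid)

lemma abs_deriv_sigmoidDeriv_le (z : ℝ) :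
    |sigmoidDeriv z * (1 - 2 * sigmoid z)| ≤ exp (-|z|) := by
  rw [abs_mul, abs_of_nonneg (sigmoidDeriv_nonneg z)]
  refine (mul_le_of_le_one_right (sigmoidDeriv_nonneg z) ?_).trans (sigmoidDeriv_le_exp z)
  have h0 := sigmoid_nonneg z
  have h1 := sigmoid_le_one z
  rw [abs_le]; constructor <;> linarith

lemma integrable_exp_neg_mul_abs {a : ℝ} (ha : 0 < a) :
    Integrable (fun x : ℝ => exp (-(a * |x|))) := by
  have h : IntegrableOn (fun x : ℝ => exp (-(a * x))) (Set.Ioi 0) := by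
    simpa [neg_mul] using integrableOn_exp_mul_Ioi (a := -a) (by linarith) 0
  have h1 : IntegrableOn (fun x : ℝ => exp (-(a * |x|))) (Set.Ioi 0) :=
    h.congr_fun (fun x hx => by simp only [abs_of_pos (Set.mem_Ioi.1 hx)]) measurableSet_Ioi
  have h2 : IntegrableOn (fun x : ℝ => exp (-(a * |x|))) (Set.Iic 0) := by
    rw [integrableOn_Iic_iff_integrableOn_Iio]
    have := h1.comp_neg
    simpa using this
  rw [← integrableOn_univ, ← Set.Iic_union_Ioi (a := (0 : ℝ))]
  exact h2.union h1

/-- Exponential decay along a linear form close to `a * u`. -/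
lemma exp_neg_abs_le {a u z C : ℝ} (ha : 0 < a) (h : |z - a * u| ≤ C) :
    exp (-|z|) ≤ exp C * exp (-(a * |u|)) := by
  rw [← exp_add, exp_le_exp]
  have h1 : |a * u| ≤ |z| + |z - a * u| := by
    have := abs_sub_abs_le_abs_sub (a * u) z
    rw [abs_sub_comm] at this
    linarith
  rw [abs_mul, abs_of_pos ha] at h1
  linarith

/-- Mean value inequality on the ball of radius `C` about `a * u`, where `exp_neg_abs_le` bounds the
derivative uniformly. -/
lemma abs_sigmoid_sub_le {a u z z' C : ℝ} (ha : 0 < a) (h : |z - a * u| ≤ C)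
    (h' : |z' - a * u| ≤ C) :
    |sigmoid z - sigmoid z'| ≤ exp C * exp (-(a * |u|)) * |z - z'| := by
  have hconv : Convex ℝ (Metric.closedBall (a * u) C) := convex_closedBall _ _
  have := hconv.norm_image_sub_le_of_norm_hasDerivWithin_le (f := sigmoid) (f' := sigmoidDeriv)
    (C := exp C * exp (-(a * |u|))) (x := z') (y := z)
    (fun x _ => (hasDerivAt_sigmoid x).hasDerivWithinAt)
    (fun x hx => ?_) (by simpa [Real.dist_eq] using h') (by simpa [Real.dist_eq] using h)
  · simpa [Real.norm_eq_abs] using this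
  · rw [Real.norm_eq_abs, abs_of_nonneg (sigmoidDeriv_nonneg x)]
    exact (sigmoidDeriv_le_exp x).trans (exp_neg_abs_le ha (by simpa [Real.dist_eq] using hx))

/-! ### Pairing `L²` functions with exponential bumps -/

section
variable {X : Type*} [MeasurableSpace X] {μ : Measure X} {u v : X → ℝ}

lemma integrable_exp_neg_mul_abs_comp (hu : MeasurePreserving u μ volume) {a : ℝ} (ha : 0 < a) :
    Integrable (fun x => exp (-(a * |u x|))) μ :=
  hu.integrable_comp_of_integrable (integrable_exp_neg_mul_abs ha)

lemma memLp_two_exp_neg_mul_abs_comp (hu : MeasurePreserving u μ volume) {a : ℝ} (ha : 0 < a) :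
    MemLp (fun x => exp (-(a * |u x|))) 2 μ := by
  have hm : Measurable fun x => exp (-(a * |u x|)) := by
    have := hu.measurable; fun_prop
  rw [memLp_two_iff_integrable_sq hm.aestronglyMeasurable]
  refine (integrable_exp_neg_mul_abs_comp hu (a := 2 * a) (by linarith)).congr (.of_forall ?_)
  intro x
  simp only
  rw [sq, ← exp_add]; ring_nf

lemma integrable_mul_exp (hu : MeasurePreserving u μ volume) {a : ℝ} (ha : 0 < a) {g : X → ℝ}
    (hg : MemLp g 2 μ) : Integrable (fun x => |g x| * exp (-(a * |u x|))) μ :=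
  MemLp.integrable_mul (f := fun x => |g x|) hg.abs (memLp_two_exp_neg_mul_abs_comp hu ha)

/-- Differentiation under the integral sign along a bounded direction `w`. -/
lemma hasDerivAt_integral_ridge (hu : MeasurePreserving u μ volume) {a : ℝ} (ha : 0 < a)
    {χ χ' : ℝ → ℝ} (hχ : ∀ z, HasDerivAt χ (χ' z) z) (hχ' : Continuous χ')
    (hb : ∀ z, |χ' z| ≤ exp (-|z|)) {g w ℓ r : X → ℝ} (hg : MemLp g 2 μ)
    (hw : Measurable w) (hw1 : ∀ᵐ x ∂μ, |w x| ≤ 1) (hℓ : Measurable ℓ) (hr : Measurable r) {C : ℝ}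
    (hℓC : ∀ᵐ x ∂μ, |ℓ x - a * u x| ≤ C) (s₀ : ℝ)
    (hint : Integrable (fun x => g x * (χ (ℓ x + s₀ * w x) - r x)) μ) :
    HasDerivAt (fun s => ∫ x, g x * (χ (ℓ x + s * w x) - r x) ∂μ)
      (∫ x, w x * g x * χ' (ℓ x + s₀ * w x) ∂μ) s₀ := by
  have hχc : Continuous χ := continuous_iff_continuousAt.2 fun z => (hχ z).continuousAt
  -- On the unit ball about `s₀`, `|s * w x| ≤ |s₀| + 1`, so a single bump in `u` dominates all the
  -- derivatives.
  refine (hasDerivAt_integral_of_dominated_loc_of_deriv_le (s := Metric.ball s₀ 1)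
    (F' := fun s x => w x * g x * χ' (ℓ x + s * w x))
    (bound := fun x => exp (C + (|s₀| + 1)) * (|g x| * exp (-(a * |u x|))))
    (Metric.ball_mem_nhds _ one_pos) (.of_forall fun s => ?_) hint ?_ ?_ ?_ ?_).2
  · exact hg.1.mul (by fun_prop : Measurable _).aestronglyMeasurable
  · exact (hw.aestronglyMeasurable.mul hg.1).mul (by fun_prop : Measurable _).aestronglyMeasurable
  · filter_upwards [hw1, hℓC] with x h1 h2 s hs
    have hs' : |s| ≤ |s₀| + 1 := by
      rw [Metric.mem_ball, Real.dist_eq] at hs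
      have := abs_sub_abs_le_abs_sub s s₀
      linarith
    have h3 : |ℓ x + s * w x - a * u x| ≤ C + (|s₀| + 1) := by
      have h4 : |s * w x| ≤ |s₀| + 1 := by
        rw [abs_mul]
        exact (mul_le_of_le_one_right (abs_nonneg s) h1).trans hs'
      calc _ = |(ℓ x - a * u x) + s * w x| := by ring_nf
        _ ≤ _ := (abs_add_le _ _).trans (add_le_add h2 h4)
    have h5 := (hb (ℓ x + s * w x)).trans (exp_neg_abs_le ha h3)
    rw [Real.norm_eq_abs, abs_mul, abs_mul]
    calc |w x| * |g x| * |χ' (ℓ x + s * w x)|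
        ≤ 1 * |g x| * (exp (C + (|s₀| + 1)) * exp (-(a * |u x|))) := by gcongr
      _ = _ := by ring
  · exact (integrable_mul_exp hu ha hg).const_mul _
  · refine .of_forall fun x s _ => ?_
    have h1 : HasDerivAt (fun s => ℓ x + s * w x) (w x) s := by
      simpa using ((hasDerivAt_id s).mul_const (w x)).const_add (ℓ x)
    have h2 := (((hχ _).comp s h1).sub_const (r x)).const_mul (g x)
    refine h2.congr_deriv ?_
    ring

/-- An `L²` function pairs with far translates of an exponential bump to zero. -/
lemma tendsto_integral_mul_exp_translate (hu : MeasurePreserving u μ volume) {a : ℝ} (ha : 0 < a)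
    {g : X → ℝ} (hg : MemLp g 2 μ) :
    Tendsto (fun c => ∫ x, |g x| * exp (-(a * |u x + c|)) ∂μ) atTop (𝓝 0) := by
  have hum := hu.measurable
  set K := ∫ x : ℝ, exp (-(a * |x|)) with hK
  have hK0 : 0 ≤ K := integral_nonneg fun _ => (exp_pos _).le
  have hKi : ∀ c, Integrable (fun x => exp (-(a * |u x + c|))) μ := fun c =>
    hu.integrable_comp_of_integrable ((integrable_exp_neg_mul_abs ha).comp_add_right c)
  have hKc : ∀ c, ∫ x, exp (-(a * |u x + c|)) ∂μ = K := fun c => by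
    rw [hK, ← integral_add_right_eq_self _ c, ← hu.map_eq, integral_map hum.aemeasurable]
    exact (by fun_prop : Measurable fun x : ℝ => exp (-(a * |x + c|))).aestronglyMeasurable
  have hg2 : Integrable (fun x => g x ^ 2) μ := hg.integrable_sq
  have he1 : ∀ z : ℝ, exp (-(a * |z|)) ≤ 1 := fun z => by
    rw [exp_le_one_iff]; have := abs_nonneg z; nlinarith
  have hQi : ∀ c, Integrable (fun x => g x ^ 2 * exp (-(a * |u x + c|))) μ := fun c => by
    refine hg2.mono' (hg2.1.mul (by fun_prop : Measurable _).aestronglyMeasurable)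
      (.of_forall fun x => ?_)
    rw [Real.norm_eq_abs, abs_of_nonneg (by positivity)]
    exact mul_le_of_le_one_right (sq_nonneg _) (he1 _)
  -- Dominated convergence needs an integrable majorant: `g ^ 2` is one, whereas `g` itself may not
  -- be integrable.
  have hQ : Tendsto (fun c => ∫ x, g x ^ 2 * exp (-(a * |u x + c|)) ∂μ) atTop (𝓝 0) := by
    have := tendsto_integral_filter_of_dominated_convergence (l := (atTop : Filter ℝ)) (μ := μ)
      (F := fun c x => g x ^ 2 * exp (-(a * |u x + c|))) (f := fun _ => 0)
      (fun x => g x ^ 2) (.of_forall fun c => (hQi c).1)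
      (.of_forall fun c => .of_forall fun x => ?_) hg2 (.of_forall fun x => ?_)
    · simpa using this
    · rw [Real.norm_eq_abs, abs_of_nonneg (by positivity)]
      exact mul_le_of_le_one_right (sq_nonneg _) (he1 _)
    · rw [← mul_zero (g x ^ 2)]
      refine Tendsto.const_mul _ (tendsto_exp_neg_atTop_nhds_zero.comp ?_)
      exact Tendsto.const_mul_atTop ha
        (tendsto_abs_atTop_atTop.comp (tendsto_atTop_add_const_left _ _ tendsto_id))
  rw [Metric.tendsto_atTop] at hQ ⊢
  intro ε hε
  set δ := ε / (K + 1) with hδ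
  have hδ0 : 0 < δ := by positivity
  obtain ⟨N, hN⟩ := hQ (ε * δ) (by positivity)
  refine ⟨N, fun c hc => ?_⟩
  have h1 := hN c hc
  rw [Real.dist_eq, sub_zero, abs_of_nonneg (integral_nonneg fun x => by positivity)] at h1 ⊢
  have h2 : ∫ x, |g x| * exp (-(a * |u x + c|)) ∂μ ≤
      ∫ x, (2 * δ)⁻¹ * (g x ^ 2 * exp (-(a * |u x + c|))) + δ / 2 * exp (-(a * |u x + c|)) ∂μ := by
    refine integral_mono_of_nonneg (.of_forall fun x => by positivity)
      (((hQi c).const_mul _).add ((hKi c).const_mul _)) (.of_forall fun x => ?_)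
    -- Weighted AM-GM passes from `g ^ 2` back to `|g|`; the leftover `δ / 2` integrates to `δ * K /
    -- 2 ≤ ε / 2` by the choice of `δ`.
    have : |g x| ≤ (2 * δ)⁻¹ * g x ^ 2 + δ / 2 := by
      rw [← sq_abs (g x), inv_mul_eq_div, div_add_div _ _ (by positivity) (by positivity),
        le_div_iff₀ (by positivity)]
      nlinarith [sq_nonneg (|g x| - δ)]
    refine (mul_le_mul_of_nonneg_right this (exp_pos _).le).trans_eq ?_
    ring
  rw [integral_add ((hQi c).const_mul _) ((hKi c).const_mul _), integral_const_mul,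
    integral_const_mul, hKc] at h2
  have h3 : δ * K ≤ ε := by
    rw [hδ, div_mul_eq_mul_div, div_le_iff₀ (by positivity)]; nlinarith
  have h4 : (2 * δ)⁻¹ * (∫ x, g x ^ 2 * exp (-(a * |u x + c|)) ∂μ) < ε / 2 := by
    rw [inv_mul_eq_div, div_lt_iff₀ (by positivity)]; nlinarith
  linarith

end

/-! ### Stability of orthogonality under multiplication by `v` -/

section
variable {X : Type*} [MeasurableSpace X] {μ : Measure X} {u v : X → ℝ}

lemma abs_ridge_sub_le {a b c s t : ℝ} (h : |t| ≤ 1) :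
    |a * s + b * t + c - a * s| ≤ |b| + |c| := by
  calc _ = |b * t + c| := by ring_nf
    _ ≤ |b * t| + |c| := abs_add_le _ _
    _ ≤ _ := by
      rw [abs_mul]
      gcongr
      exact mul_le_of_le_one_right (abs_nonneg b) h

lemma abs_mul_sigmoidDeriv_le {a b c s t y : ℝ} (ha : 0 < a) (h : |t| ≤ 1) :
    ‖y * sigmoidDeriv (a * s + b * t + c)‖ ≤ exp (|b| + |c|) * (|y| * exp (-(a * |s|))) := by
  rw [Real.norm_eq_abs, abs_mul, abs_of_nonneg (sigmoidDeriv_nonneg _)]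
  have h1 := (sigmoidDeriv_le_exp _).trans
    (exp_neg_abs_le ha (abs_ridge_sub_le (a := a) (b := b) (c := c) (s := s) h))
  refine (mul_le_mul_of_nonneg_left h1 (abs_nonneg y)).trans_eq ?_
  ring

lemma integrable_mul_sigmoidDeriv (hu : MeasurePreserving u μ volume) (hv : Measurable v)
    (hv1 : ∀ᵐ x ∂μ, |v x| ≤ 1) {a : ℝ} (ha : 0 < a) {g : X → ℝ} (hg : MemLp g 2 μ) (b c : ℝ) :
    Integrable (fun x => g x * sigmoidDeriv (a * u x + b * v x + c)) μ := by
  have hum := hu.measurable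
  have := continuous_sigmoidDeriv
  refine ((integrable_mul_exp hu ha hg).const_mul (exp (|b| + |c|))).mono'
    (hg.1.mul (by fun_prop : Measurable _).aestronglyMeasurable) ?_
  filter_upwards [hv1] with x hx
  exact abs_mul_sigmoidDeriv_le ha hx

lemma memLp_two_sigmoid_sub (hu : MeasurePreserving u μ volume) (hv : Measurable v)
    (hv1 : ∀ᵐ x ∂μ, |v x| ≤ 1) {a : ℝ} (ha : 0 < a) (b c c' : ℝ) :
    MemLp (fun x => sigmoid (a * u x + b * v x + c) - sigmoid (a * u x + b * v x + c')) 2 μ := by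
  have hum := hu.measurable
  have := continuous_sigmoid
  refine ((memLp_two_exp_neg_mul_abs_comp hu ha).const_mul
    (exp (|b| + (|c| + |c'|)) * |c - c'|)).of_le (by fun_prop : Measurable _).aestronglyMeasurable ?_
  filter_upwards [hv1] with x hx
  rw [Real.norm_eq_abs]
  have h1 : |b| + |c| ≤ |b| + (|c| + |c'|) := by have := abs_nonneg c'; linarith
  have h2 : |b| + |c'| ≤ |b| + (|c| + |c'|) := by have := abs_nonneg c; linarith
  refine (abs_sigmoid_sub_le ha ((abs_ridge_sub_le hx).trans h1)
    ((abs_ridge_sub_le hx).trans h2)).trans ?_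
  rw [add_sub_add_left_eq_sub]
  refine le_trans (le_of_eq ?_) (le_abs_self _)
  ring

lemma integrable_mul_sigmoid_sub (hu : MeasurePreserving u μ volume) (hv : Measurable v)
    (hv1 : ∀ᵐ x ∂μ, |v x| ≤ 1) {a : ℝ} (ha : 0 < a) {g : X → ℝ} (hg : MemLp g 2 μ) (b c c' : ℝ) :
    Integrable (fun x => g x *
      (sigmoid (a * u x + b * v x + c) - sigmoid (a * u x + b * v x + c'))) μ :=
  hg.integrable_mul (memLp_two_sigmoid_sub hu hv hv1 ha b c c')

lemma sigmoidDeriv_abs_le (z : ℝ) : |sigmoidDeriv z| ≤ exp (-|z|) := by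
  rw [abs_of_nonneg (sigmoidDeriv_nonneg z)]; exact sigmoidDeriv_le_exp z

lemma hasDerivAt_integral_mul_sigmoid_sub (hu : MeasurePreserving u μ volume) (hv : Measurable v)
    (hv1 : ∀ᵐ x ∂μ, |v x| ≤ 1) {a : ℝ} (ha : 0 < a) {g : X → ℝ} (hg : MemLp g 2 μ) (b c c' : ℝ) :
    HasDerivAt (fun c => ∫ x, g x *
        (sigmoid (a * u x + b * v x + c) - sigmoid (a * u x + b * v x + c')) ∂μ)
      (∫ x, g x * sigmoidDeriv (a * u x + b * v x + c) ∂μ) c := by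
  have hum := hu.measurable
  have := continuous_sigmoid
  -- The direction `w = 1` varies `c`. The reference ridge `r` makes the integrand integrable and
  -- drops out of the derivative.
  have h := hasDerivAt_integral_ridge (χ' := sigmoidDeriv) (w := fun _ => 1) (ℓ := fun x => a * u x + b * v x)
    (r := fun x => sigmoid (a * u x + b * v x + c')) (C := |b| + |0|) hu ha
    hasDerivAt_sigmoid continuous_sigmoidDeriv sigmoidDeriv_abs_le hg measurable_const
    (by simp) (by fun_prop) (by fun_prop)
    (by filter_upwards [hv1] with x hx using by
          simpa using abs_ridge_sub_le (a := a) (b := b) (c := 0) (s := u x) hx) c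
    (by simpa using integrable_mul_sigmoid_sub hu hv hv1 ha hg b c c')
  simpa using h

lemma integral_mul_sigmoidDeriv_eq_zero (hu : MeasurePreserving u μ volume) (hv : Measurable v)
    (hv1 : ∀ᵐ x ∂μ, |v x| ≤ 1) {a : ℝ} (ha : 0 < a) {g : X → ℝ} (hg : MemLp g 2 μ)
    (h : ∀ b c c', ∫ x, g x *
      (sigmoid (a * u x + b * v x + c) - sigmoid (a * u x + b * v x + c')) ∂μ = 0) (b c : ℝ) :
    ∫ x, g x * sigmoidDeriv (a * u x + b * v x + c) ∂μ = 0 := by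
  have h1 := hasDerivAt_integral_mul_sigmoid_sub hu hv hv1 ha hg b c 0
  simp only [h] at h1
  exact h1.unique (hasDerivAt_const c 0)

/-- As a function of `c` the integral has zero derivative, and it vanishes at `c = c'`. -/
lemma integral_mul_sigmoid_sub_eq_zero (hu : MeasurePreserving u μ volume) (hv : Measurable v)
    (hv1 : ∀ᵐ x ∂μ, |v x| ≤ 1) {a : ℝ} (ha : 0 < a) {g : X → ℝ} (hg : MemLp g 2 μ)
    (h : ∀ b c, ∫ x, g x * sigmoidDeriv (a * u x + b * v x + c) ∂μ = 0) (b c c' : ℝ) :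
    ∫ x, g x *
      (sigmoid (a * u x + b * v x + c) - sigmoid (a * u x + b * v x + c')) ∂μ = 0 := by
  have h1 := fun c => hasDerivAt_integral_mul_sigmoid_sub hu hv hv1 ha hg b c c'
  simp only [h] at h1
  have h2 := is_const_of_deriv_eq_zero (fun c => (h1 c).differentiableAt) (fun c => (h1 c).deriv) c c'
  simpa using h2

lemma MeasureTheory.MemLp.bounded_mul {p : ENNReal} {g : X → ℝ} (hg : MemLp g p μ)
    (hv : Measurable v) (hv1 : ∀ᵐ x ∂μ, |v x| ≤ 1) : MemLp (fun x => v x * g x) p μ := by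
  refine hg.of_le (hv.aestronglyMeasurable.mul hg.1) ?_
  filter_upwards [hv1] with x hx
  rw [norm_mul]
  exact mul_le_of_le_one_left (norm_nonneg _) hx

/-- The functions orthogonal to all ridge bumps are stable under multiplication by the bounded
coordinate. -/
lemma integral_coord_mul_sigmoidDeriv_eq_zero (hu : MeasurePreserving u μ volume)
    (hv : Measurable v) (hv1 : ∀ᵐ x ∂μ, |v x| ≤ 1) {a : ℝ} (ha : 0 < a) {g : X → ℝ}
    (hg : MemLp g 2 μ)
    (h : ∀ b c, ∫ x, g x * sigmoidDeriv (a * u x + b * v x + c) ∂μ = 0) (b c : ℝ) :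
    ∫ x, v x * g x * sigmoidDeriv (a * u x + b * v x + c) ∂μ = 0 := by
  have hum := hu.measurable
  have hcs := continuous_sigmoidDeriv
  have hcs' : Continuous fun z => sigmoidDeriv z * (1 - 2 * sigmoid z) :=
    hcs.mul (continuous_const.sub (continuous_const.mul continuous_sigmoid))
  have hvg : MemLp (fun x => v x * g x) 2 μ := hg.bounded_mul hv hv1
  have hderiv : ∀ c, HasDerivAt
      (fun c => ∫ x, v x * g x * sigmoidDeriv (a * u x + b * v x + c) ∂μ) 0 c := by
    intro c
    -- The same integral `∫ v g σ''` arises as a `b`-derivative of the pairing with `g`, which is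
    -- identically zero, and as a `c`-derivative of the pairing with `v g`.
    have hb := hasDerivAt_integral_ridge (w := v) (ℓ := fun x => a * u x + c)
      (r := fun _ => 0) (C := |c|) hu ha hasDerivAt_sigmoidDeriv hcs'
      abs_deriv_sigmoidDeriv_le hg hv hv1 (by fun_prop) (by fun_prop) (by simp) b
      (by simpa [add_right_comm] using integrable_mul_sigmoidDeriv hu hv hv1 ha hg b c)
    have hc := hasDerivAt_integral_ridge (w := fun _ => 1) (ℓ := fun x => a * u x + b * v x)
      (r := fun _ => 0) (C := |b| + |0|) hu ha hasDerivAt_sigmoidDeriv hcs'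
      abs_deriv_sigmoidDeriv_le hvg measurable_const (by simp) (by fun_prop) (by fun_prop)
      (by filter_upwards [hv1] with x hx using by
            simpa using abs_ridge_sub_le (a := a) (b := b) (c := 0) (s := u x) hx) c
      (by simpa using integrable_mul_sigmoidDeriv hu hv hv1 ha hvg b c)
    simp only [sub_zero, add_right_comm _ c, h] at hb
    have hb0 := hb.unique (hasDerivAt_const b 0)
    simp only [sub_zero, mul_one, one_mul] at hc
    rwa [hb0] at hc
  have hconst := fun c => is_const_of_deriv_eq_zero (fun c => (hderiv c).differentiableAt)
    (fun c => (hderiv c).deriv) c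
  have hlim : Tendsto (fun c => ∫ x, v x * g x * sigmoidDeriv (a * u x + b * v x + c) ∂μ)
      atTop (𝓝 0) := by
    -- Since `a u + c = a (u + c / a)`, the bump is a translate by `c / a`; the term `b v` costs
    -- only the factor `exp |b|`.
    have hT := ((tendsto_integral_mul_exp_translate hu ha hvg).const_mul (exp |b|)).comp
      (tendsto_id.atTop_div_const ha)
    rw [mul_zero] at hT
    refine squeeze_zero_norm (fun c => ?_) hT
    have hi : Integrable (fun x => |v x * g x| * exp (-(a * |u x + c / a|))) μ := by
      refine ((integrable_mul_exp hu ha hvg).const_mul (exp |c|)).mono'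
        (hvg.1.norm.mul (by fun_prop : Measurable _).aestronglyMeasurable) (.of_forall fun x => ?_)
      rw [Real.norm_eq_abs, abs_of_nonneg (by positivity)]
      have h1 : |a * (u x + c / a) - a * u x| ≤ |c| := by
        rw [mul_add, mul_div_cancel₀ _ ha.ne']; simp
      have h2 := exp_neg_abs_le ha h1
      rw [abs_mul, abs_of_pos ha] at h2
      refine (mul_le_mul_of_nonneg_left h2 (abs_nonneg _)).trans_eq ?_
      ring
    simp only [Function.comp_apply, id_eq]
    rw [← integral_const_mul]
    refine norm_integral_le_of_norm_le (hi.const_mul _) ?_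
    filter_upwards [hv1] with x hx
    rw [norm_mul, Real.norm_eq_abs, Real.norm_eq_abs, abs_of_nonneg (sigmoidDeriv_nonneg _)]
    have h1 : |a * u x + b * v x + c - a * (u x + c / a)| ≤ |b| := by
      rw [mul_add, mul_div_cancel₀ _ ha.ne']
      calc _ = |b * v x| := by ring_nf
        _ ≤ _ := by rw [abs_mul]; exact mul_le_of_le_one_right (abs_nonneg b) hx
    have h2 := (sigmoidDeriv_le_exp _).trans (exp_neg_abs_le ha h1)
    refine (mul_le_mul_of_nonneg_left h2 (abs_nonneg _)).trans_eq ?_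
    ring
  refine tendsto_nhds_unique (tendsto_const_nhds.congr fun c' => ?_) hlim
  exact hconst c c'

lemma integral_pow_mul_sigmoid_sub_eq_zero (hu : MeasurePreserving u μ volume)
    (hv : Measurable v) (hv1 : ∀ᵐ x ∂μ, |v x| ≤ 1) {a : ℝ} (ha : 0 < a) {g : X → ℝ}
    (hg : MemLp g 2 μ)
    (h : ∀ b c c', ∫ x, g x *
      (sigmoid (a * u x + b * v x + c) - sigmoid (a * u x + b * v x + c')) ∂μ = 0)
    (n : ℕ) (c c' : ℝ) :
    ∫ x, v x ^ n * g x * (sigmoid (a * u x + c) - sigmoid (a * u x + c')) ∂μ = 0 := by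
  -- The induction must carry every `b`, because each new factor `v` comes from differentiating in
  -- `b`.
  have key : MemLp (fun x => v x ^ n * g x) 2 μ ∧
      ∀ b c, ∫ x, v x ^ n * g x * sigmoidDeriv (a * u x + b * v x + c) ∂μ = 0 := by
    induction n with
    | zero => simpa using ⟨hg, integral_mul_sigmoidDeriv_eq_zero hu hv hv1 ha hg h⟩
    | succ n ih =>
      have e : (fun x => v x ^ (n + 1) * g x) = fun x => v x * (v x ^ n * g x) := by
        ext x; ring
      rw [e]
      refine ⟨ih.1.bounded_mul hv hv1, fun b c => ?_⟩
      rw [← integral_coord_mul_sigmoidDeriv_eq_zero hu hv hv1 ha ih.1 ih.2 b c]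
      simp only [pow_succ', mul_assoc]
  simpa using integral_mul_sigmoid_sub_eq_zero hu hv hv1 ha key.1 key.2 0 c c'

/-! ### Steep sigmoids and integrals over slabs -/

/-- A majorant independent of `a`, for dominated convergence as `a → ∞`. Left of `p` and right of
`q` the exponential tails only improve as `a` grows; in between, the trivial bound `1` suffices. -/
lemma sigmoid_sub_abs_le {a p q s : ℝ} (ha : 1 ≤ a) (hpq : p ≤ q) :
    |sigmoid (a * s + -(a * p)) - sigmoid (a * s + -(a * q))| ≤
      exp (|p| + |q|) * exp (-(1 * |s|)) := by
  have hmono : sigmoid (a * s + -(a * q)) ≤ sigmoid (a * s + -(a * p)) := by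
    apply sigmoid_le; nlinarith
  rw [abs_of_nonneg (sub_nonneg.2 hmono), ← exp_add]
  have h0 := sigmoid_nonneg (a * s + -(a * q))
  have h1 := sigmoid_le_one (a * s + -(a * p))
  have hp := neg_abs_le p
  have hp' := le_abs_self p
  have hq := neg_abs_le q
  have hq' := le_abs_self q
  rcases le_total s p with hs | hs
  · have h2 := sigmoid_le_exp (a * s + -(a * p))
    have h3 : exp (a * s + -(a * p)) ≤ exp (|p| + |q| + -(1 * |s|)) := by
      rw [exp_le_exp]
      rcases abs_cases s with ⟨e, _⟩ | ⟨e, _⟩ <;> rw [e] <;> nlinarith [abs_nonneg q]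
    linarith
  · rcases le_total s q with hs' | hs'
    · have h3 : 1 ≤ exp (|p| + |q| + -(1 * |s|)) := by
        rw [one_le_exp_iff]
        rcases abs_cases s with ⟨e, _⟩ | ⟨e, _⟩ <;> rw [e] <;>
          linarith [abs_nonneg q, abs_nonneg p]
      linarith
    · have h2 := one_sub_sigmoid_le_exp_neg (a * s + -(a * q))
      have h3 : exp (-(a * s + -(a * q))) ≤ exp (|p| + |q| + -(1 * |s|)) := by
        rw [exp_le_exp]
        rcases abs_cases s with ⟨e, _⟩ | ⟨e, _⟩ <;> rw [e] <;> nlinarith [abs_nonneg p]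
      linarith

lemma tendsto_sigmoid_sub_indicator {p q s : ℝ} (hpq : p < q) (hp : s ≠ p) (hq : s ≠ q) :
    Tendsto (fun a : ℝ => sigmoid (a * s + -(a * p)) - sigmoid (a * s + -(a * q))) atTop
      (𝓝 ((Set.Ioo p q).indicator 1 s)) := by
  have hpos : ∀ r, r < s → Tendsto (fun a : ℝ => sigmoid (a * s + -(a * r))) atTop (𝓝 1) := by
    intro r hr
    refine tendsto_sigmoid_atTop.comp ?_
    have : (fun a : ℝ => a * s + -(a * r)) = fun a => a * (s - r) := by ext; ring
    rw [this]
    exact tendsto_id.atTop_mul_const (sub_pos.2 hr)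
  have hneg : ∀ r, s < r → Tendsto (fun a : ℝ => sigmoid (a * s + -(a * r))) atTop (𝓝 0) := by
    intro r hr
    refine tendsto_sigmoid_atBot.comp ?_
    have : (fun a : ℝ => a * s + -(a * r)) = fun a => a * (s - r) := by ext; ring
    rw [this]
    exact tendsto_id.atTop_mul_const_of_neg (sub_neg.2 hr)
  rcases lt_or_gt_of_ne hp with h | h
  · rw [Set.indicator_of_notMem (by simp [h.le])]
    simpa using (hneg p h).sub (hneg q (h.trans hpq))
  · rcases lt_or_gt_of_ne hq with h' | h'
    · rw [Set.indicator_of_mem (Set.mem_Ioo.2 ⟨h, h'⟩)]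
      simpa using (hpos p h).sub (hneg q h')
    · rw [Set.indicator_of_notMem (by simp [h'.le])]
      simpa using (hpos p h).sub (hpos q h')

lemma setIntegral_preimage_Ioo_eq_zero (hu : MeasurePreserving u μ volume) {g : X → ℝ}
    (hg : MemLp g 2 μ)
    (h : ∀ a, 0 < a → ∀ c c', ∫ x, g x * (sigmoid (a * u x + c) - sigmoid (a * u x + c')) ∂μ = 0)
    {p q : ℝ} (hpq : p < q) : ∫ x in u ⁻¹' Set.Ioo p q, g x ∂μ = 0 := by
  have hum := hu.measurable
  have := continuous_sigmoid
  -- At the endpoints `p`, `q` one sigmoid stays at `1 / 2`, but these level sets are null.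
  have hne : ∀ r, ∀ᵐ x ∂μ, u x ≠ r := fun r =>
    hu.quasiMeasurePreserving.ae (Measure.ae_ne volume r)
  have hlim := tendsto_integral_filter_of_dominated_convergence (l := (atTop : Filter ℝ)) (μ := μ)
    (F := fun a x => g x * (sigmoid (a * u x + -(a * p)) - sigmoid (a * u x + -(a * q))))
    (f := fun x => g x * (Set.Ioo p q).indicator 1 (u x))
    (fun x => exp (|p| + |q|) * (|g x| * exp (-(1 * |u x|))))
    (.of_forall fun a => hg.1.mul (by fun_prop : Measurable _).aestronglyMeasurable)
    ?_ ((integrable_mul_exp hu one_pos hg).const_mul _) ?_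
  · rw [← integral_indicator (hum measurableSet_Ioo)]
    have he : ∀ x, g x * (Set.Ioo p q).indicator 1 (u x) = (u ⁻¹' Set.Ioo p q).indicator g x := by
      intro x
      by_cases hx : u x ∈ Set.Ioo p q
      · rw [Set.indicator_of_mem hx, Set.indicator_of_mem (s := u ⁻¹' Set.Ioo p q) hx]; simp
      · rw [Set.indicator_of_notMem hx, Set.indicator_of_notMem (s := u ⁻¹' Set.Ioo p q) hx,
          mul_zero]
    simp only [he] at hlim
    refine tendsto_nhds_unique hlim (tendsto_const_nhds.congr' ?_)
    filter_upwards [eventually_gt_atTop 0] with a ha using (h a ha _ _).symm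
  · filter_upwards [eventually_ge_atTop 1] with a ha
    refine .of_forall fun x => ?_
    rw [norm_mul, Real.norm_eq_abs, Real.norm_eq_abs]
    refine (mul_le_mul_of_nonneg_left (sigmoid_sub_abs_le ha hpq.le) (abs_nonneg _)).trans_eq ?_
    ring
  · filter_upwards [hne p, hne q] with x h1 h2
    exact (tendsto_sigmoid_sub_indicator hpq h1 h2).const_mul _

end

/-! ### Uniqueness for signed densities -/

section
variable {X : Type*} [MeasurableSpace X] {μ : Measure X} {u v : X → ℝ}

/-- Encodes the signed measure `h μ` as a pair of finite positive measures, so that uniqueness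
theorems for finite measures apply to it. -/
lemma withDensity_ofReal_apply_eq_iff {h : X → ℝ} (hh : Integrable h μ) {S : Set X}
    (hS : MeasurableSet S) :
    μ.withDensity (fun x => ENNReal.ofReal (h x)) S =
      μ.withDensity (fun x => ENNReal.ofReal (-h x)) S ↔ ∫ x in S, h x ∂μ = 0 := by
  have hi := hh.integrableOn (s := S)
  have h1 : ∫⁻ x in S, ENNReal.ofReal (h x) ∂μ ≠ ⊤ :=
    (hi.lintegral_lt_top).ne
  have h2 : ∫⁻ x in S, ENNReal.ofReal (-h x) ∂μ ≠ ⊤ :=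
    (hi.neg.lintegral_lt_top).ne
  rw [withDensity_apply _ hS, withDensity_apply _ hS, ← ENNReal.toReal_eq_toReal_iff' h1 h2,
    integral_eq_lintegral_pos_part_sub_lintegral_neg_part hi, sub_eq_zero]

lemma isFiniteMeasure_withDensity_ofReal_neg {h : X → ℝ} (hh : Integrable h μ) :
    IsFiniteMeasure (μ.withDensity (fun x => ENNReal.ofReal (-h x))) :=
  isFiniteMeasure_withDensity_ofReal hh.neg.2

/-- Two finite Borel densities pushed to `Y` agree iff the signed density integrates to zero over
every preimage. -/
lemma map_withDensity_ofReal_eq_iff {Y : Type*} [MeasurableSpace Y] {T : X → Y} (hT : Measurable T)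
    {h : X → ℝ} (hh : Integrable h μ) :
    (μ.withDensity (fun x => ENNReal.ofReal (h x))).map T =
      (μ.withDensity (fun x => ENNReal.ofReal (-h x))).map T ↔
      ∀ A, MeasurableSet A → ∫ x in T ⁻¹' A, h x ∂μ = 0 := by
  rw [Measure.ext_iff]
  refine forall₂_congr fun A hA => ?_
  rw [Measure.map_apply hT hA, Measure.map_apply hT hA,
    withDensity_ofReal_apply_eq_iff hh (hT hA)]

lemma setIntegral_preimage_eq_zero_of_Ioo (hu : Measurable u) {h : X → ℝ} (hh : Integrable h μ)
    (h0 : ∀ p q, p < q → ∫ x in u ⁻¹' Set.Ioo p q, h x ∂μ = 0) {A : Set ℝ}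
    (hA : MeasurableSet A) : ∫ x in u ⁻¹' A, h x ∂μ = 0 := by
  have := isFiniteMeasure_withDensity_ofReal hh.2
  have := isFiniteMeasure_withDensity_ofReal_neg hh
  refine (map_withDensity_ofReal_eq_iff hu hh).1 (Real.measure_ext_Ioo_rat fun p q => ?_) A hA
  rw [Measure.map_apply hu measurableSet_Ioo, Measure.map_apply hu measurableSet_Ioo]
  rcases lt_or_ge (p : ℝ) q with hpq | hpq
  · exact (withDensity_ofReal_apply_eq_iff hh (hu measurableSet_Ioo)).2 (h0 p q hpq)
  · simp [Set.Ioo_eq_empty_of_le hpq]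

/-- Uniqueness in the Hausdorff moment problem for signed densities. -/
lemma setIntegral_preimage_eq_zero_of_moments (hv : Measurable v)
    (hv01 : ∀ᵐ x ∂μ, v x ∈ Set.Icc (0 : ℝ) 1) {h : X → ℝ} (hh : Integrable h μ)
    (h0 : ∀ n : ℕ, ∫ x, v x ^ n * h x ∂μ = 0) {B : Set ℝ} (hB : MeasurableSet B) :
    ∫ x in v ⁻¹' B, h x ∂μ = 0 := by
  have := isFiniteMeasure_withDensity_ofReal hh.2
  have := isFiniteMeasure_withDensity_ofReal_neg hh
  have hvn : ∀ n : ℕ, Integrable (fun x => v x ^ n * h x) μ := fun n => by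
    refine hh.norm.mono' ((hv.pow_const n).aestronglyMeasurable.mul hh.1) ?_
    filter_upwards [hv01] with x hx
    rw [norm_mul, norm_pow]
    refine mul_le_of_le_one_left (norm_nonneg _) (pow_le_one₀ (norm_nonneg _) ?_)
    rw [Real.norm_eq_abs, abs_of_nonneg hx.1]; exact hx.2
  have hpoly : ∀ p : Polynomial ℝ, Integrable (fun x => p.eval (v x) * h x) μ ∧
      ∫ x, p.eval (v x) * h x ∂μ = 0 := by
    intro p
    induction p using Polynomial.induction_on' with
    | add p q hp hq =>
      simp only [Polynomial.eval_add, add_mul]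
      exact ⟨hp.1.add hq.1, by rw [integral_add hp.1 hq.1, hp.2, hq.2, add_zero]⟩
    | monomial n c =>
      simp only [Polynomial.eval_monomial, mul_assoc]
      exact ⟨(hvn n).const_mul c, by rw [integral_const_mul, h0, mul_zero]⟩
  have hcont : ∀ φ : BoundedContinuousFunction ℝ ℝ,
      Integrable (fun x => φ (v x) * h x) μ ∧ ∫ x, φ (v x) * h x ∂μ = 0 := by
    intro φ
    have hi : Integrable (fun x => φ (v x) * h x) μ :=
      hh.bdd_mul (φ.continuous.measurable.comp hv).aestronglyMeasurable
        (.of_forall fun x => φ.norm_coe_le_norm _)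
    refine ⟨hi, ?_⟩
    have hbound : ∀ ε > 0, |∫ x, φ (v x) * h x ∂μ| ≤ ε * ∫ x, |h x| ∂μ := by
      intro ε hε
      obtain ⟨p, hp⟩ := exists_polynomial_near_of_continuousOn 0 1 φ φ.continuous.continuousOn ε hε
      have e : ∫ x, φ (v x) * h x ∂μ = ∫ x, (φ (v x) * h x - p.eval (v x) * h x) ∂μ := by
        rw [integral_sub hi (hpoly p).1, (hpoly p).2, sub_zero]
      rw [e, ← Real.norm_eq_abs, ← integral_const_mul]
      refine norm_integral_le_of_norm_le (hh.abs.const_mul ε) ?_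
      filter_upwards [hv01] with x hx
      rw [← sub_mul, norm_mul, Real.norm_eq_abs, Real.norm_eq_abs, abs_sub_comm]
      exact mul_le_mul_of_nonneg_right (hp _ hx).le (abs_nonneg _)
    by_contra hne
    have hpos := abs_pos.2 hne
    have hI : 0 ≤ ∫ x, |h x| ∂μ := integral_nonneg fun x => abs_nonneg _
    -- With this `ε` the bound falls below half of the integral's own absolute value; the `+ 1`
    -- covers `∫ |h| = 0`.
    have := hbound (|∫ x, φ (v x) * h x ∂μ| / (2 * (∫ x, |h x| ∂μ + 1))) (by positivity)
    rw [div_mul_eq_mul_div, le_div_iff₀ (by positivity)] at this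
    nlinarith
  refine (map_withDensity_ofReal_eq_iff hv hh).1
    (ext_of_forall_integral_eq_of_IsFiniteMeasure fun φ => ?_) B hB
  have hm : AEMeasurable (fun x => ENNReal.ofReal (h x)) μ := hh.1.aemeasurable.ennreal_ofReal
  have hm' : AEMeasurable (fun x => ENNReal.ofReal (-h x)) μ :=
    hh.1.aemeasurable.neg.ennreal_ofReal
  rw [integral_map hv.aemeasurable φ.continuous.aestronglyMeasurable,
    integral_map hv.aemeasurable φ.continuous.aestronglyMeasurable,
    integral_withDensity_eq_integral_toReal_smul₀ hm (.of_forall fun _ => ENNReal.ofReal_lt_top),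
    integral_withDensity_eq_integral_toReal_smul₀ hm' (.of_forall fun _ => ENNReal.ofReal_lt_top),
    ← sub_eq_zero, ← integral_sub]
  · rw [← (hcont φ).2]
    refine integral_congr_ae (.of_forall fun x => ?_)
    simp only [ENNReal.toReal_ofReal', smul_eq_mul, ← sub_mul]
    rw [mul_comm, max_zero_sub_max_neg_zero_eq_self]
  · simp only [ENNReal.toReal_ofReal', smul_eq_mul]
    exact (hh.pos_part.bdd_mul (φ.continuous.measurable.comp hv).aestronglyMeasurable
      (.of_forall fun x => φ.norm_coe_le_norm _)).congr (.of_forall fun x => mul_comm _ _)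
  · simp only [ENNReal.toReal_ofReal', smul_eq_mul]
    exact (hh.neg_part.bdd_mul (φ.continuous.measurable.comp hv).aestronglyMeasurable
      (.of_forall fun x => φ.norm_coe_le_norm _)).congr (.of_forall fun x => mul_comm _ _)

/-- A density vanishing on all coordinate rectangles is zero. -/
lemma ae_eq_zero_of_setIntegral_rectangles (hT : MeasurableEmbedding fun x => (u x, v x))
    {h : X → ℝ} (hh : Integrable h μ)
    (h0 : ∀ A B, MeasurableSet A → MeasurableSet B → ∫ x in u ⁻¹' A ∩ v ⁻¹' B, h x ∂μ = 0) :
    h =ᵐ[μ] 0 := by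
  have := isFiniteMeasure_withDensity_ofReal hh.2
  have := isFiniteMeasure_withDensity_ofReal_neg hh
  have hmap : (μ.withDensity (fun x => ENNReal.ofReal (h x))).map (fun x => (u x, v x)) =
      (μ.withDensity (fun x => ENNReal.ofReal (-h x))).map (fun x => (u x, v x)) := by
    have hrect : ∀ A B : Set ℝ, MeasurableSet A → MeasurableSet B →
        (μ.withDensity (fun x => ENNReal.ofReal (h x))).map (fun x => (u x, v x)) (A ×ˢ B) =
        (μ.withDensity (fun x => ENNReal.ofReal (-h x))).map (fun x => (u x, v x)) (A ×ˢ B) := by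
      intro A B hA hB
      rw [Measure.map_apply hT.measurable (hA.prod hB), Measure.map_apply hT.measurable (hA.prod hB),
        withDensity_ofReal_apply_eq_iff hh (hT.measurable (hA.prod hB))]
      exact h0 A B hA hB
    refine ext_of_generate_finite _ generateFrom_prod.symm isPiSystem_prod ?_ ?_
    · rintro _ ⟨A, hA, B, hB, rfl⟩
      exact hrect A B hA hB
    · rw [← Set.univ_prod_univ]
      exact hrect _ _ .univ .univ
  have hset := (map_withDensity_ofReal_eq_iff hT.measurable hh).1 hmap
  refine hh.ae_eq_zero_of_forall_setIntegral_eq_zero fun S hS _ => ?_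
  -- Since `(u, v)` is an embedding, every measurable `S` is the preimage of its measurable image.
  rw [← hset _ (hT.measurableSet_image.2 hS), Set.preimage_image_eq _ hT.injective]

/-- An `L²` function orthogonal to all differences of parallel logistic ridges vanishes. -/
lemma ae_eq_zero_of_integral_sigmoid_sub (hu : MeasurePreserving u μ volume)
    (hv : Measurable v) (hv01 : ∀ᵐ x ∂μ, v x ∈ Set.Icc (0 : ℝ) 1)
    (hT : MeasurableEmbedding fun x => (u x, v x)) {g : X → ℝ} (hg : MemLp g 2 μ)
    (h : ∀ a, 0 < a → ∀ b c c', ∫ x, g x *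
      (sigmoid (a * u x + b * v x + c) - sigmoid (a * u x + b * v x + c')) ∂μ = 0) :
    g =ᵐ[μ] 0 := by
  have hum := hu.measurable
  have hv1 : ∀ᵐ x ∂μ, |v x| ≤ 1 := by
    filter_upwards [hv01] with x hx
    rw [abs_of_nonneg hx.1]; exact hx.2
  have hpow : ∀ n : ℕ, MemLp (fun x => v x ^ n * g x) 2 μ := fun n =>
    hg.bounded_mul (hv.pow_const n) <| by
      filter_upwards [hv1] with x hx
      rw [abs_pow]; exact pow_le_one₀ (abs_nonneg _) hx
  -- Slabs have finite measure, so truncation makes the `L²` function `g` integrable, as the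
  -- uniqueness lemmas require.
  have hloc : ∀ (N : ℕ), (u ⁻¹' Set.Ioo (-N : ℝ) N).indicator g =ᵐ[μ] 0 := by
    intro N
    set D := u ⁻¹' Set.Ioo (-N : ℝ) N with hD
    have hDm : MeasurableSet D := hum measurableSet_Ioo
    have hDfin : μ D ≠ ⊤ := by
      rw [hD, hu.measure_preimage measurableSet_Ioo.nullMeasurableSet]; simp
    have hint : ∀ n : ℕ, Integrable (D.indicator fun x => v x ^ n * g x) μ := fun n => by
      rw [integrable_indicator_iff hDm]
      have : IsFiniteMeasure (μ.restrict D) := ⟨by simpa using hDfin.lt_top⟩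
      exact ((hpow n).restrict D).integrable one_le_two
    have hmul : ∀ n x, D.indicator (fun x => v x ^ n * g x) x = v x ^ n * D.indicator g x :=
      fun n x => Set.indicator_mul_right _ _ _
    have hint0 : Integrable (D.indicator g) μ := by simpa using hint 0
    have hA : ∀ (n : ℕ) A, MeasurableSet A →
        ∫ x in u ⁻¹' A, D.indicator (fun x => v x ^ n * g x) x ∂μ = 0 := by
      intro n A hA
      refine setIntegral_preimage_eq_zero_of_Ioo hum (hint n) (fun p q hpq => ?_) hA
      rw [setIntegral_indicator hDm, hD, ← Set.preimage_inter, Set.Ioo_inter_Ioo]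
      rcases lt_or_ge (max p (-N : ℝ)) (min q N) with hlt | hge
      · exact setIntegral_preimage_Ioo_eq_zero hu (hpow n) (fun a ha c c' =>
          integral_pow_mul_sigmoid_sub_eq_zero hu hv hv1 ha hg (h a ha) n c c') hlt
      · rw [Set.Ioo_eq_empty_of_le hge]; simp
    refine ae_eq_zero_of_setIntegral_rectangles hT hint0 fun A B hAm hBm => ?_
    have hAu := hum hAm
    have := setIntegral_preimage_eq_zero_of_moments hv hv01 (hint0.indicator hAu) (fun n => ?_) hBm
    · rwa [setIntegral_indicator hAu, Set.inter_comm] at this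
    · rw [← hA n A hAm, ← integral_indicator hAu]
      refine integral_congr_ae (.of_forall fun x => ?_)
      rw [funext (hmul n)]
      exact (Set.indicator_mul_right (u ⁻¹' A) (fun x => v x ^ n) _).symm
  filter_upwards [ae_all_iff.2 hloc] with x hx
  obtain ⟨N, hN⟩ := exists_nat_gt |u x|
  rw [← hx N, Set.indicator_of_mem]
  exact abs_lt.1 hN

end

/-! ### Network subspaces of `L²` and the strip -/

lemma shallowNetworks_eq_span (n : ℕ) (ψ : ℝ → ℝ) :
    shallowNetworks n ψ = (Submodule.span ℝ
      (Set.range fun p : EuclideanSpace ℝ (Fin n) × ℝ => ridge ψ p.1 p.2) :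
        Set (EuclideanSpace ℝ (Fin n) → ℝ)) := by
  ext G
  constructor
  · rintro ⟨k, t, y, θ, rfl⟩
    exact Submodule.sum_mem _ fun i _ =>
      Submodule.smul_mem _ _ (Submodule.subset_span ⟨(y i, θ i), rfl⟩)
  · intro hG
    rw [SetLike.mem_coe, Submodule.mem_span_set'] at hG
    obtain ⟨k, t, w, rfl⟩ := hG
    choose p hp using fun i => (w i).2
    exact ⟨k, t, fun i => (p i).1, fun i => (p i).2,
      Finset.sum_congr rfl fun i _ => by rw [← hp i]⟩

/-- The functions of a linear space `S` that are square integrable on `U`, as a subspace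
of `L²(U)`. -/
def interL2Submodule {n : ℕ} (S : Submodule ℝ (EuclideanSpace ℝ (Fin n) → ℝ))
    (U : Set (EuclideanSpace ℝ (Fin n))) : Submodule ℝ (L2On U) where
  carrier := interL2 (S : Set _) U
  zero_mem' := ⟨0, S.zero_mem, MemLp.zero, (MemLp.toLp_zero _).symm⟩
  add_mem' := by
    rintro _ _ ⟨G, hG, hG2, rfl⟩ ⟨H, hH, hH2, rfl⟩
    exact ⟨G + H, S.add_mem hG hH, hG2.add hH2, (MemLp.toLp_add _ _).symm⟩
  smul_mem' := by
    rintro c _ ⟨G, hG, hG2, rfl⟩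
    exact ⟨c • G, S.smul_mem c hG, hG2.const_smul c, (MemLp.toLp_const_smul _ _).symm⟩

/-- The measurable coordinate equivalence between the Euclidean plane and `ℝ × ℝ`. -/
def planeEquiv : EuclideanSpace ℝ (Fin 2) ≃ᵐ ℝ × ℝ :=
  (MeasurableEquiv.toLp 2 (Fin 2 → ℝ)).symm.trans MeasurableEquiv.finTwoArrow

lemma planeEquiv_apply (x : EuclideanSpace ℝ (Fin 2)) : planeEquiv x = (x 0, x 1) := rfl

lemma measurePreserving_planeEquiv :
    MeasurePreserving planeEquiv volume (volume : Measure (ℝ × ℝ)) :=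
  (PiLp.volume_preserving_ofLp (Fin 2)).trans (volume_preserving_finTwoArrow ℝ)

lemma measurableSet_strip : MeasurableSet strip :=
  (by fun_prop : Measurable fun x : EuclideanSpace ℝ (Fin 2) => x 1) measurableSet_Icc

/-- The fibre `[0, 1]` has length one, so projecting it away preserves measure. -/
lemma measurePreserving_strip_fst :
    MeasurePreserving (fun x : EuclideanSpace ℝ (Fin 2) => x 0) (volume.restrict strip)
      volume := by
  have hs : planeEquiv ⁻¹' (Set.univ ×ˢ Set.Icc (0 : ℝ) 1) = strip := by
    ext x; simp [planeEquiv_apply, strip]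
  have h1 := measurePreserving_planeEquiv.restrict_preimage
    (s := Set.univ ×ˢ Set.Icc (0 : ℝ) 1) (MeasurableSet.univ.prod measurableSet_Icc)
  rw [hs, Measure.volume_eq_prod, ← Measure.prod_restrict, Measure.restrict_univ] at h1
  have : IsProbabilityMeasure ((volume : Measure ℝ).restrict (Set.Icc (0 : ℝ) 1)) :=
    ⟨by simp⟩
  exact measurePreserving_fst.comp h1

theorem theorem1 :
    closure (interL2 (shallowNetworks 2 Real.sigmoid) strip) = (Set.univ : Set (L2On strip)) := by
  set S := Submodule.span ℝ
    (Set.range fun p : EuclideanSpace ℝ (Fin 2) × ℝ => ridge sigmoid p.1 p.2) with hS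
  rw [shallowNetworks_eq_span]
  change closure ((interL2Submodule S strip : Submodule ℝ (L2On strip)) : Set (L2On strip)) = _
  rw [← Submodule.topologicalClosure_coe, ← Submodule.top_coe (R := ℝ), SetLike.coe_set_eq,
    Submodule.topologicalClosure_eq_top_iff, Submodule.eq_bot_iff]
  intro f hf
  rw [Submodule.mem_orthogonal] at hf
  have hu := measurePreserving_strip_fst
  have hv : Measurable fun x : EuclideanSpace ℝ (Fin 2) => x 1 := by fun_prop
  have hv01 : ∀ᵐ x ∂(volume.restrict strip : Measure (EuclideanSpace ℝ (Fin 2))),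
      x 1 ∈ Set.Icc (0 : ℝ) 1 := ae_restrict_mem measurableSet_strip
  have hv1 : ∀ᵐ x ∂(volume.restrict strip : Measure (EuclideanSpace ℝ (Fin 2))),
      |x 1| ≤ 1 := by
    filter_upwards [hv01] with x hx
    rw [abs_of_nonneg hx.1]; exact hx.2
  rw [Lp.eq_zero_iff_ae_eq_zero]
  refine ae_eq_zero_of_integral_sigmoid_sub hu hv hv01 planeEquiv.measurableEmbedding (Lp.memLp f)
    fun a ha b c c' => ?_
  have hmem := memLp_two_sigmoid_sub hu hv hv1 ha b c c'
  have hridge : ∀ θ, ridge sigmoid !₂[a, b] θ = fun x => sigmoid (a * x 0 + b * x 1 + θ) := by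
    intro θ
    ext x
    simp [ridge, PiLp.inner_apply, Fin.sum_univ_two, mul_comm]
  have hin : hmem.toLp _ ∈ interL2Submodule S strip := by
    refine ⟨_, ?_, hmem, rfl⟩
    -- Each ridge separately is only in `S`; square integrability holds for the difference.
    have := S.sub_mem (Submodule.subset_span ⟨(!₂[a, b], c), rfl⟩)
      (Submodule.subset_span ⟨(!₂[a, b], c'), rfl⟩)
    simp only [hridge] at this
    exact this
  have h0 := hf _ hin
  rw [L2.inner_def] at h0
  rw [← h0]
  refine integral_congr_ae ?_
  filter_upwards [hmem.coeFn_toLp] with x hx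
  rw [hx]
  simp
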